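/- Let $G$ be a group, let $P\subseteq G$ be a submonoid (a subsemigroup containing the identity), and let $\Sigma$ be a finite set generating $P$ as a monoid. Assume: (a) $P\subseteq G$ is left quasi-lattice ordered, that is, $P$ contains no non-trivial units and for all $x,y\in G$ either $xP\cap yP=\varnothing$ or there is $z\in G$ with $xP\cap yP=zP$; moreover $P$ is right Ore, that is, $pP\cap qP\neq\varnothing$ for all $p,q\in P$; and $G$ is the enveloping group of $P$, that is, $G=PP^{-1}$. (b) For all $x,y,z\in G$ with $xP\cap yP=zP$ and every $s\in\Sigma$, either $xsP\cap yP=zP$ or there is $t\in\Sigma$ with $xsP\cap yP=ztP$. (c) For every finite subset $F\subseteq\Sigma$ and every $s\in\Sigma\setminus F$, $\;sP\cap\bigcap_{t\in F}tP\subsetneq\bigcap_{t\in F}tP$ (where the intersection over $F=\varnothing$ is $G$). Then $G$ is of type FL, that is, the trivial $\mathbb{Z}G$-module $\mathbb{Z}$ has a resolution of finite length by finitely generated free $\mathbb{Z}G$-modules, and the cohomological dimension of $G$ (the projective dimension of the trivial $\mathbb{Z}G$-module $\mathbb{Z}$) is at most $|\Sigma|$. In particular, $H_i(G,M)=0$ and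 $H^i(G,M)=0$ for every $i>|\Sigma|$ and every $\mathbb{Z}G$-module $M$. -/

import Mathlib

open scoped Pointwise MonoidAlgebra

universe u

/-- The submonoid `P` of the group `G` is left quasi-lattice ordered: it has no non-trivial units,
and the intersection of two translates `xP`, `yP` with `x, y ∈ G` is empty or again a translate
`zP` with `z ∈ G`. -/
def IsLeftQuasiLatticeOrdered {G : Type u} [Group G] (P : Submonoid G) : Prop :=
  (∀ p ∈ P, p⁻¹ ∈ P → p = 1) ∧
    ∀ x y : G, x • (P : Set G) ∩ y • (P : Set G) = ∅ ∨
      ∃ z : G, x • (P : Set G) ∩ y • (P : Set G) = z • (P : Set G)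

/-- The submonoid `P` of a group (which is automatically cancellative) is right Ore: any two of its
elements have a common right multiple, i.e. `pP ∩ qP` is non-empty. -/
def IsRightOre {G : Type u} [Group G] (P : Submonoid G) : Prop :=
  ∀ p ∈ P, ∀ q ∈ P, (p • (P : Set G) ∩ q • (P : Set G)).Nonempty

/-- `G` is the enveloping group of its (right Ore) submonoid `P`, i.e. its group of right
fractions: `G = P P⁻¹`. -/
def IsEnvelopingGroup {G : Type u} [Group G] (P : Submonoid G) : Prop :=
  ∀ g : G, ∃ p ∈ P, ∃ q ∈ P, g = p * q⁻¹

/-- The trivial `ℤG`-module `ℤ` (lifted to the universe of `G`). -/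
noncomputable def trivialModuleInt (G : Type u) [Group G] : ModuleCat.{u} ℤ[G] :=
  Rep.toModuleMonoidAlgebra.obj (Rep.trivial ℤ G (ULift.{u} ℤ))

/-- `G` is of type FL: the trivial `ℤG`-module `ℤ` has a resolution of finite length
`0 → Fₙ → ⋯ → F₀ → ℤ → 0` by finitely generated free `ℤG`-modules. -/
def IsTypeFL (G : Type u) [Group G] : Prop :=
  ∃ (F : CategoryTheory.ProjectiveResolution (trivialModuleInt G)) (n : ℕ),
    (∀ i, Module.Free ℤ[G] (F.complex.X i) ∧ Module.Finite ℤ[G] (F.complex.X i)) ∧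
      ∀ i, n < i → CategoryTheory.Limits.IsZero (F.complex.X i)

/-- The cohomological dimension of `G`: the projective dimension of the trivial `ℤG`-module `ℤ`. -/
noncomputable def cohomologicalDimension (G : Type u) [Group G] : WithBot ℕ∞ :=
  CategoryTheory.projectiveDimension (trivialModuleInt G)

/-- A `ℤG`-module `M`, viewed as an additive group on which `G` acts linearly. Mathlib's group
(co)homology wants the ring of coefficients in the universe of `G`, so `ℤ` is lifted there. -/
noncomputable def moduleToRep (G : Type u) [Group G] (M : Type u) [AddCommGroup M]
    [Module ℤ[G] M] : Rep.{u} (ULift.{u} ℤ) G :=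
  Rep.of (X := M)
    { toFun := fun g =>
        { toFun := fun m => MonoidAlgebra.of ℤ G g • m
          map_add' := fun m m' => smul_add _ m m'
          map_smul' := fun c m => by
            change MonoidAlgebra.of ℤ G g • (c.down • m) = c.down • (MonoidAlgebra.of ℤ G g • m)
            exact smul_comm _ _ _ }
      map_one' := by
        ext m
        change MonoidAlgebra.of ℤ G 1 • m = m
        rw [map_one, one_smul]
      map_mul' := fun g h => by
        ext m
        change MonoidAlgebra.of ℤ G (g * h) • m
          = MonoidAlgebra.of ℤ G g • (MonoidAlgebra.of ℤ G h • m)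
        rw [map_mul, mul_smul] }

/-- The homology `H_i(G, M)` of the group `G` with coefficients in the `ℤG`-module `M`. -/
noncomputable abbrev integralGroupHomology (G : Type u) [Group G] (M : Type u) [AddCommGroup M]
    [Module ℤ[G] M] (i : ℕ) : ModuleCat (ULift.{u} ℤ) :=
  groupHomology (moduleToRep G M) i

/-- The cohomology `H^i(G, M)` of the group `G` with coefficients in the `ℤG`-module `M`. -/
noncomputable abbrev integralGroupCohomology (G : Type u) [Group G] (M : Type u) [AddCommGroup M]
    [Module ℤ[G] M] (i : ℕ) : ModuleCat (ULift.{u} ℤ) :=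
  groupCohomology (moduleToRep G M) i

/-! Order `G` by left divisibility, `x ≤ y` when `x⁻¹y ∈ P`. By (a) any two elements have a join. By
(b) and (c), distinct generators `a`, `c` satisfy `a ∨ c = a * star a c`, where the residual `star a
c` is again a generator. So each `g` and each set of directions `A ⊆ Σ` span a cube, with edges from
`g` to `g * a` and the joins as further vertices. The oriented cubes form the complex `R[G] ⊗
⋀(R^Σ)` of finitely generated free modules, which vanishes above degree `|Σ|`. The boundary
subtracts from the near faces, at `g`, the far faces, at `g * a`, whose directions are residuals
along `a`.

For exactness, consider cubes inside an interval `[y, z]`. By (b), joining with `y * s` moves each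
`g ≥ y` by at most one generator `t`; adding the direction `t` to cubes is a homotopy from the
identity to a map into `[y * s, z]`. Induction along a word for `y⁻¹z` shrinks the interval to a
point (`exists_homotopy`, `exists_d_eq`). Every chain lies in some interval because the order is
directed in both directions. Upper bounds are joins; lower bounds come from the join `D` of all
generators, a Garside element: conjugation by `D` permutes `Σ` (`exists_garside`,
`exists_common_lower_bound`).

Only `|F| ≤ 2` matters in (c): generators are non-trivial, pairwise incomparable, and not below the
join of two others. The last fact makes residuals injective. -/

open scoped TensorProduct
open CategoryTheory

universe w

/-! ### Contraction and wedge on exterior powers. -/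

namespace exteriorPower

variable {R : Type*} [CommRing R] {V W : Type*} [AddCommGroup V] [Module R V]
  [AddCommGroup W] [Module R W]

theorem contractLeft_mem (d : Module.Dual R V) (n : ℕ) (x : ExteriorAlgebra R V)
    (hx : x ∈ ⋀[R]^(n + 1) V) :
    CliffordAlgebra.contractLeft (Q := (0 : QuadraticForm R V)) d x ∈ ⋀[R]^n V := by
  induction n generalizing x with
  | zero =>
    rw [ExteriorAlgebra.exteriorPower, zero_add, pow_one] at hx
    obtain ⟨v, rfl⟩ := hx
    rw [ExteriorAlgebra.exteriorPower, pow_zero]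
    have h : CliffordAlgebra.contractLeft (Q := (0 : QuadraticForm R V)) d
      (ExteriorAlgebra.ι R v) = algebraMap R _ (d v) := CliffordAlgebra.contractLeft_ι _ _ _
    rw [h]
    exact Submodule.algebraMap_mem _
  | succ n ih =>
    rw [ExteriorAlgebra.exteriorPower, pow_succ'] at hx
    induction hx using Submodule.mul_induction_on' with
    | mem_mul_mem a ha b hb =>
      obtain ⟨v, rfl⟩ := ha
      have h : CliffordAlgebra.contractLeft (Q := (0 : QuadraticForm R V)) d
        (ExteriorAlgebra.ι R v * b) = d v • b - ExteriorAlgebra.ι R v *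
          CliffordAlgebra.contractLeft (Q := (0 : QuadraticForm R V)) d b :=
        CliffordAlgebra.contractLeft_ι_mul _ _ _
      rw [h]
      refine Submodule.sub_mem _ (Submodule.smul_mem _ _ hb) ?_
      rw [ExteriorAlgebra.exteriorPower, pow_succ']
      exact Submodule.mul_mem_mul (LinearMap.mem_range_self _ v) (ih b hb)
    | add a _ b _ ha hb => rw [map_add]; exact Submodule.add_mem _ ha hb

/-- Contraction of an exterior power with a linear form. -/
noncomputable def contract (d : Module.Dual R V) (n : ℕ) : ⋀[R]^(n + 1) V →ₗ[R] ⋀[R]^n V :=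
  (CliffordAlgebra.contractLeft (Q := (0 : QuadraticForm R V)) d).restrict
    (fun x hx => contractLeft_mem d n x hx)

/-- Left exterior multiplication with a vector. -/
noncomputable def wedge (v : V) (n : ℕ) : ⋀[R]^n V →ₗ[R] ⋀[R]^(n + 1) V :=
  (LinearMap.mulLeft R (ExteriorAlgebra.ι R v)).restrict (fun x hx => by
    rw [ExteriorAlgebra.exteriorPower, pow_succ']
    exact Submodule.mul_mem_mul (LinearMap.mem_range_self _ v) hx)

theorem coe_contract (d : Module.Dual R V) (n : ℕ) (x : ⋀[R]^(n + 1) V) :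
    (contract d n x : ExteriorAlgebra R V) =
      CliffordAlgebra.contractLeft (Q := (0 : QuadraticForm R V)) d (x : ExteriorAlgebra R V) :=
  rfl

theorem coe_wedge (v : V) (n : ℕ) (x : ⋀[R]^n V) :
    (wedge v n x : ExteriorAlgebra R V) = ExteriorAlgebra.ι R v * x := rfl

theorem coe_map (n : ℕ) (f : V →ₗ[R] W) (x : ⋀[R]^n V) :
    (map n f x : ExteriorAlgebra R W) = ExteriorAlgebra.map f (x : ExteriorAlgebra R V) := by
  have hx : x ∈ Submodule.span R (Set.range (ιMulti R n (M := V))) := by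
    rw [ιMulti_span]; trivial
  induction hx using Submodule.span_induction with
  | mem x h =>
    obtain ⟨m, rfl⟩ := h
    rw [map_apply_ιMulti, ιMulti_apply_coe, ιMulti_apply_coe, ExteriorAlgebra.map_apply_ιMulti]
  | zero => simp
  | add x y _ _ hx hy => simp only [map_add, Submodule.coe_add, hx, hy]
  | smul r x _ hx => simp only [map_smul, Submodule.coe_smul, hx]

theorem contractLeft_map (d : Module.Dual R W) (f : V →ₗ[R] W) (x : ExteriorAlgebra R V) :
    CliffordAlgebra.contractLeft (Q := (0 : QuadraticForm R W)) d (ExteriorAlgebra.map f x) =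
      ExteriorAlgebra.map f
        (CliffordAlgebra.contractLeft (Q := (0 : QuadraticForm R V)) (d ∘ₗ f) x) := by
  induction x using CliffordAlgebra.left_induction with
  | algebraMap r =>
    rw [CliffordAlgebra.contractLeft_algebraMap, map_zero]
    erw [AlgHom.commutes, CliffordAlgebra.contractLeft_algebraMap]
  | add x y hx hy => simp only [map_add, hx, hy]
  | ι_mul x m hx =>
    have h : ExteriorAlgebra.map f (CliffordAlgebra.ι (0 : QuadraticForm R V) m) =
      CliffordAlgebra.ι (0 : QuadraticForm R W) (f m) := ExteriorAlgebra.map_apply_ι f m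
    rw [map_mul, CliffordAlgebra.contractLeft_ι_mul, h]
    erw [CliffordAlgebra.contractLeft_ι_mul]
    rw [hx, map_sub, map_mul, map_smul, h]
    rfl

theorem contract_map (d : Module.Dual R W) (f : V →ₗ[R] W) (n : ℕ) (x : ⋀[R]^(n + 1) V) :
    contract d n (map (n + 1) f x) = map n f (contract (d ∘ₗ f) n x) := by
  apply Subtype.ext
  rw [coe_contract, coe_map, coe_map, coe_contract, contractLeft_map]

theorem map_wedge (f : V →ₗ[R] W) (v : V) (n : ℕ) (x : ⋀[R]^n V) :
    map (n + 1) f (wedge v n x) = wedge (f v) n (map n f x) := by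
  apply Subtype.ext
  rw [coe_wedge, coe_map, coe_map, coe_wedge, map_mul, ExteriorAlgebra.map_apply_ι]

theorem contract_comm (d d' : Module.Dual R V) (n : ℕ) (x : ⋀[R]^(n + 1 + 1) V) :
    contract d n (contract d' (n + 1) x) = -contract d' n (contract d (n + 1) x) :=
  Subtype.ext (CliffordAlgebra.contractLeft_comm (Q := (0 : QuadraticForm R V)) _ _ _)

theorem contract_contract (d : Module.Dual R V) (n : ℕ) (x : ⋀[R]^(n + 1 + 1) V) :
    contract d n (contract d (n + 1) x) = 0 :=
  Subtype.ext (CliffordAlgebra.contractLeft_contractLeft (Q := (0 : QuadraticForm R V)) _ _)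

theorem contract_wedge (d : Module.Dual R V) (v : V) (n : ℕ) (x : ⋀[R]^(n + 1) V) :
    contract d (n + 1) (wedge v (n + 1) x) = d v • x - wedge v n (contract d n x) :=
  Subtype.ext (CliffordAlgebra.contractLeft_ι_mul (Q := (0 : QuadraticForm R V)) _ _ _)

/-- In degree zero the correction term of the Leibniz rule is absent, since contraction kills
scalars. -/
theorem contract_wedge_zero (d : Module.Dual R V) (v : V) (x : ⋀[R]^0 V) :
    contract d 0 (wedge v 0 x) = d v • x := by
  apply Subtype.ext
  have h := CliffordAlgebra.contractLeft_ι_mul (Q := (0 : QuadraticForm R V)) d v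
    (x : ExteriorAlgebra R V)
  obtain ⟨x, hx⟩ := x
  rw [ExteriorAlgebra.exteriorPower, pow_zero] at hx
  obtain ⟨r, rfl⟩ := Submodule.mem_one.1 hx
  rw [coe_contract, coe_wedge, ExteriorAlgebra.ι]
  refine h.trans ?_
  erw [CliffordAlgebra.contractLeft_algebraMap]
  simp

theorem contract_sum {ι : Type*} (s : Finset ι) (d : ι → Module.Dual R V) (n : ℕ)
    (x : ⋀[R]^(n + 1) V) :
    contract (∑ i ∈ s, d i) n x = ∑ i ∈ s, contract (d i) n x := by
  apply Subtype.ext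
  rw [coe_contract, map_sum, LinearMap.sum_apply, AddSubmonoidClass.coe_finsetSum]
  rfl

theorem contract_sub (d d' : Module.Dual R V) (n : ℕ) (x : ⋀[R]^(n + 1) V) :
    contract (d - d') n x = contract d n x - contract d' n x := by
  apply Subtype.ext
  rw [coe_contract, map_sub, LinearMap.sub_apply]
  rfl

end exteriorPower

/-! ### Free modules over the group ring. -/

section GroupRingTensor

variable {R : Type*} [CommRing R] {G : Type*} [Group G] {M N : Type*}
  [AddCommGroup M] [Module R M] [AddCommGroup N] [Module R N]

/-- The element `g ⊗ m` of the free `R[G]`-module on `M`. -/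
noncomputable def cell (g : G) : M →ₗ[R] R[G] ⊗[R] M :=
  TensorProduct.mk R R[G] M (MonoidAlgebra.of R G g)

theorem of_smul_cell (g h : G) (m : M) :
    MonoidAlgebra.of R G g • (cell h m : R[G] ⊗[R] M) = cell (g * h) m := by
  simp only [cell, TensorProduct.mk_apply, TensorProduct.smul_tmul', smul_eq_mul, map_mul]

theorem span_cell : Submodule.span R {c : R[G] ⊗[R] M | ∃ g m, c = cell g m} = ⊤ := by
  rw [eq_top_iff]
  rintro c -
  induction c using TensorProduct.induction_on with
  | zero => exact zero_mem _
  | add x y hx hy => exact add_mem hx hy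
  | tmul a m =>
    induction a using MonoidAlgebra.induction_on with
    | of g => exact Submodule.subset_span ⟨g, m, rfl⟩
    | add a b ha hb => rw [TensorProduct.add_tmul]; exact add_mem ha hb
    | smul r a ha => rw [← TensorProduct.smul_tmul']; exact Submodule.smul_mem _ _ ha

/-- Scalars can be absorbed into `m`, so closure under addition suffices. -/
theorem cell_induction {p : R[G] ⊗[R] M → Prop} (c : R[G] ⊗[R] M)
    (h0 : p 0) (hadd : ∀ a b, p a → p b → p (a + b)) (hcell : ∀ g m, p (cell g m)) : p c := by
  have hc : c ∈ Submodule.span R {c : R[G] ⊗[R] M | ∃ g m, c = cell g m} := by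
    rw [span_cell]; trivial
  have hs : ∀ (r : R) (x : R[G] ⊗[R] M),
      x ∈ Submodule.span R {c : R[G] ⊗[R] M | ∃ g m, c = cell g m} → p (r • x) := by
    intro r x hx
    induction hx using Submodule.span_induction generalizing r with
    | mem x h => obtain ⟨g, m, rfl⟩ := h; rw [← map_smul]; exact hcell _ _
    | zero => rwa [smul_zero]
    | add x y _ _ hx hy => rw [smul_add]; exact hadd _ _ (hx r) (hy r)
    | smul s x _ hx => rw [smul_smul]; exact hx _
  simpa using hs 1 c hc

/-- The `R`-linear map on `R[G] ⊗ M` given by a family of linear maps indexed by `G`. -/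
noncomputable def cellLift (f : G → M →ₗ[R] N) : R[G] ⊗[R] M →ₗ[R] N :=
  TensorProduct.lift (Finsupp.linearCombination R f ∘ₗ
    (MonoidAlgebra.coeffLinearEquiv R (S := R) (M := G)).toLinearMap)

theorem cellLift_cell (f : G → M →ₗ[R] N) (g : G) (m : M) : cellLift f (cell g m) = f g m := by
  simp [cellLift, cell]

variable [Module R[G] N] [IsScalarTower R R[G] N]

/-- The extension of an `R`-linear map on `M` to an `R[G]`-linear map on `R[G] ⊗ M`. -/
noncomputable def equivariantLift (f : M →ₗ[R] N) : R[G] ⊗[R] M →ₗ[R[G]] N :=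
  TensorProduct.AlgebraTensorModule.lift (LinearMap.toSpanSingleton R[G] (M →ₗ[R] N) f)

theorem equivariantLift_cell (f : M →ₗ[R] N) (g : G) (m : M) :
    equivariantLift f (cell g m) = MonoidAlgebra.of R G g • f m := by
  simp [equivariantLift, cell]

end GroupRingTensor

/-! ### The cube complex and its differential. -/

namespace CubeComplex
open exteriorPower

variable (R : Type*) [CommRing R] {G : Type*} [Group G] {S : Type*} [DecidableEq S]

/-- The linear map on `R^S` given by taking residuals along `a`. -/
noncomputable def residual (star : S → S → S) (a : S) : (S →₀ R) →ₗ[R] (S →₀ R) :=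
  Finsupp.linearCombination R fun c => if c = a then 0 else Finsupp.single (star a c) 1

theorem residual_single_self (star : S → S → S) (a : S) :
    residual R star a (Finsupp.single a 1) = 0 := by
  simp [residual]

theorem residual_single (star : S → S → S) {a c : S} (h : c ≠ a) :
    residual R star a (Finsupp.single c 1) = Finsupp.single (star a c) 1 := by
  simp [residual, h]

variable {v : S → G} {star : S → S → S}

/-- The lattice-theoretic identities between the values of a residual. -/
structure IsCubical (v : S → G) (star : S → S → S) : Prop where
  mul_star : ∀ a c, a ≠ c → v a * v (star a c) = v c * v (star c a)
  star_injective : ∀ a b c, b ≠ a → c ≠ a → star a b = star a c → b = c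
  star_star : ∀ a b c, a ≠ b → b ≠ c → a ≠ c →
    star (star a c) (star a b) = star (star c a) (star c b)

/-- On a third direction this is `star_star`, where injectivity ensures that the second residual
does not kill the image of the first. On `a` and `c` both sides vanish. -/
theorem IsCubical.residual_comm (h : IsCubical v star) {a c : S} (hac : a ≠ c) :
    residual R star (star a c) ∘ₗ residual R star a =
      residual R star (star c a) ∘ₗ residual R star c := by
  refine Finsupp.lhom_ext' fun b => LinearMap.ext_ring ?_
  simp only [LinearMap.comp_apply, Finsupp.lsingle_apply]
  by_cases hba : b = a
  · subst hba
    rw [residual_single_self, residual_single R star hac, residual_single_self, map_zero]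
  by_cases hbc : b = c
  · subst hbc
    rw [residual_single_self, residual_single R star hba, residual_single_self, map_zero]
  rw [residual_single R star hba, residual_single R star hbc,
    residual_single R star fun e => hbc (h.star_injective a b c hba hac.symm e),
    residual_single R star fun e => hba (h.star_injective c b a hbc hac e),
    h.star_star a b c (Ne.symm hba) hbc hac]

variable [Fintype S]

/-- The sum of the coordinates. -/
noncomputable def coordSum (S : Type*) [Fintype S] : Module.Dual R (S →₀ R) :=
  ∑ a, Finsupp.lapply a

theorem coordSum_single (a : S) : coordSum R S (Finsupp.single a 1) = 1 := by
  simp [coordSum, Finsupp.single_apply]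

theorem coordSum_comp_residual (star : S → S → S) (a : S) :
    coordSum R S ∘ₗ residual R star a = coordSum R S - Finsupp.lapply a := by
  refine Finsupp.lhom_ext' fun c => LinearMap.ext_ring ?_
  by_cases h : c = a
  · subst h
    simp [residual_single_self, coordSum_single]
  · simp [residual_single R star h, coordSum_single, h]

theorem lapply_comp_residual (star : S → S → S) (a b : S) :
    Finsupp.lapply b ∘ₗ residual R star a =
      ∑ c, if c ≠ a ∧ star a c = b then (Finsupp.lapply c : Module.Dual R (S →₀ R)) else 0 := by
  refine Finsupp.lhom_ext' fun c => LinearMap.ext_ring ?_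
  simp only [LinearMap.comp_apply, Finsupp.lsingle_apply, Finsupp.lapply_apply,
    LinearMap.sum_apply]
  have : ∀ x, (if x ≠ a ∧ star a x = b then (Finsupp.lapply x : Module.Dual R (S →₀ R)) else 0)
      (Finsupp.single c 1) = if c = x then (if c ≠ a ∧ star a c = b then (1 : R) else 0) else 0 := by
    intro x
    by_cases hx : c = x
    · subst hx
      simp only [if_true]
      split_ifs <;> simp
    · rw [if_neg hx]
      split_ifs
      · simp [hx]
      · rfl
  simp only [this, Finset.sum_ite_eq, Finset.mem_univ, if_true]
  by_cases h : c = a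
  · subst h; simp [residual_single_self]
  · simp [residual_single R star h, h, Finsupp.single_apply]

/-- The `R[G]`-module of `n`-chains: it is free on the translates of the faces of dimension `n`. -/
abbrev Chains (G S : Type*) [Group G] (n : ℕ) : Type _ := R[G] ⊗[R] ⋀[R]^n (S →₀ R)

variable {R}

/-- The differential of the cube complex. -/
noncomputable def d (v : S → G) (star : S → S → S) (n : ℕ) :
    Chains R G S (n + 1) →ₗ[R[G]] Chains R G S n :=
  equivariantLift (cell 1 ∘ₗ contract (coordSum R S) n -
    ∑ a, cell (v a) ∘ₗ map n (residual R star a) ∘ₗ contract (Finsupp.lapply a) n)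

theorem d_cell (n : ℕ) (g : G) (w : ⋀[R]^(n + 1) (S →₀ R)) :
    d v star n (cell g w) = cell g (contract (coordSum R S) n w) -
      ∑ a, cell (g * v a) (map n (residual R star a) (contract (Finsupp.lapply a) n w)) := by
  simp only [d, equivariantLift_cell, LinearMap.sub_apply, LinearMap.comp_apply,
    LinearMap.sum_apply, smul_sub, Finset.smul_sum, of_smul_cell, mul_one]

/-- The coordinate `b` pulls back along the residual to the sum of the coordinates `c` with `star a
c = b`. Hence each `c ≠ a` contributes exactly once, to `b = star a c`. -/
theorem sum_cell_residual_contract_residual (n : ℕ) (a : S) (g : G)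
    (w : ⋀[R]^(n + 1) (S →₀ R)) :
    ∑ b, cell (g * v b) (map n (residual R star b) (contract (Finsupp.lapply b) n
        (map (n + 1) (residual R star a) w))) =
      ∑ c, if c ≠ a then (cell (g * v (star a c)) (map n (residual R star (star a c))
        (map n (residual R star a) (contract (Finsupp.lapply c) n w))) : Chains R G S n)
        else 0 := by
  have key : ∀ b, contract (Finsupp.lapply b) n (map (n + 1) (residual R star a) w) =
      ∑ c, if c ≠ a ∧ star a c = b then
        map n (residual R star a) (contract (Finsupp.lapply c) n w) else 0 := by
    intro b
    rw [contract_map, lapply_comp_residual, contract_sum, map_sum]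
    refine Finset.sum_congr rfl fun c _ => ?_
    split_ifs
    · rfl
    · have : contract (0 : Module.Dual R (S →₀ R)) n w = 0 := by
        simpa using contract_sum (∅ : Finset S) (fun _ => 0) n w
      rw [this, map_zero]
  simp only [key, map_sum]
  rw [Finset.sum_comm]
  refine Finset.sum_congr rfl fun c _ => ?_
  by_cases hc : c = a
  · simp [hc]
  · simp only [hc, ne_eq, not_false_eq_true, true_and, if_true]
    rw [Finset.sum_eq_single (star a c)]
    · simp
    · intro b _ hb
      rw [if_neg (Ne.symm hb)]
      simp
    · simp

/-- Near faces of near faces cancel because a contraction squares to zero. Far faces of far faces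
cancel in pairs `(a, b)`, `(b, a)`: they are the same cell by `mul_star` and `residual_comm`, with
opposite signs. The mixed terms cancel because contractions anticommute. -/
theorem d_d (h : IsCubical v star) (n : ℕ) (c : Chains R G S (n + 1 + 1)) :
    d v star n (d v star (n + 1) c) = 0 := by
  induction c using cell_induction with
  | h0 => simp
  | hadd a b ha hb => rw [map_add, map_add, ha, hb, add_zero]
  | hcell g w =>
    have h2 : ∑ a, ∑ b, (if b ≠ a then (cell (g * v a * v (star a b))
        (map n (residual R star (star a b)) (map n (residual R star a)
        (contract (Finsupp.lapply b) n (contract (Finsupp.lapply a) (n + 1) w)))) :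
          Chains R G S n) else 0) = 0 := by
      rw [← Finset.sum_product']
      refine Finset.sum_involution (fun p _ => (p.2, p.1)) ?_ ?_ (by simp) (by simp)
      · rintro ⟨a, b⟩ -
        by_cases hab : a = b
        · simp [hab]
        · have e1 : g * v b * v (star b a) = g * v a * v (star a b) := by
            rw [mul_assoc, mul_assoc, h.mul_star a b hab]
          have e2 : ∀ x : ⋀[R]^n (S →₀ R), map n (residual R star (star b a))
              (map n (residual R star b) x) = map n (residual R star (star a b))
              (map n (residual R star a) x) := fun x => by
            rw [← LinearMap.comp_apply, ← LinearMap.comp_apply, ← map_comp, ← map_comp,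
              h.residual_comm R hab]
          simp only [ne_eq, hab, Ne.symm hab, not_false_eq_true, if_true]
          rw [e1, e2, contract_comm (Finsupp.lapply b : Module.Dual R (S →₀ R)), map_neg, map_neg, map_neg,
            neg_add_cancel]
      · rintro ⟨a, b⟩ - hne heq
        simp only [Prod.mk.injEq] at heq
        simp only [ne_eq, ite_eq_right_iff, Classical.not_imp] at hne
        exact (hne.1 heq.1).elim
    have h1 : ∀ a, (contract (coordSum R S) n (map (n + 1) (residual R star a)
        (contract (Finsupp.lapply a) (n + 1) w))) =
        map n (residual R star a) (contract (coordSum R S) n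
          (contract (Finsupp.lapply a) (n + 1) w)) := fun a => by
      rw [contract_map, coordSum_comp_residual, contract_sub, contract_contract, sub_zero]
    simp only [d_cell, map_sub, map_sum, Finset.sum_sub_distrib, h1,
      sum_cell_residual_contract_residual, h2]
    rw [contract_contract, map_zero, zero_sub, sub_zero, ← neg_add', neg_eq_zero,
      ← Finset.sum_add_distrib]
    refine Finset.sum_eq_zero fun a _ => ?_
    rw [contract_comm, map_neg, map_neg, neg_add_cancel]

end CubeComplex

/-! ### The homotopy that moves cells by one step. -/

namespace CubeComplex
open exteriorPower

variable {R : Type*} [CommRing R] {G : Type*} [Group G] {S : Type*}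

/-- The homotopy which adds the direction `o g` to the cells at `g`. -/
noncomputable def homotopy (o : G → Option S) (n : ℕ) :
    Chains R G S n →ₗ[R] Chains R G S (n + 1) :=
  cellLift fun g => (o g).elim 0 fun t => cell g ∘ₗ wedge (Finsupp.single t 1) n

variable {o : G → Option S}

theorem homotopy_cell_none {g : G} (hg : o g = none) (n : ℕ) (w : ⋀[R]^n (S →₀ R)) :
    homotopy o n (cell g w) = 0 := by
  simp [homotopy, cellLift_cell, hg]

theorem homotopy_cell_some {g : G} {t : S} (hg : o g = some t) (n : ℕ) (w : ⋀[R]^n (S →₀ R)) :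
    homotopy o n (cell g w) = cell g (wedge (Finsupp.single t 1) n w) := by
  simp [homotopy, cellLift_cell, hg]

variable [DecidableEq S]

/-- The map which moves the cells at `g` along the direction `o g`. -/
noncomputable def push (v : S → G) (star : S → S → S) (o : G → Option S) (n : ℕ) :
    Chains R G S n →ₗ[R] Chains R G S n :=
  cellLift fun g => (o g).elim (cell g) fun t => cell (g * v t) ∘ₗ map n (residual R star t)

variable {v : S → G} {star : S → S → S}

theorem push_cell_none {g : G} (hg : o g = none) (n : ℕ) (w : ⋀[R]^n (S →₀ R)) :
    push v star o n (cell g w) = cell g w := by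
  simp [push, cellLift_cell, hg]

theorem push_cell_some {g : G} {t : S} (hg : o g = some t) (n : ℕ) (w : ⋀[R]^n (S →₀ R)) :
    push v star o n (cell g w) = cell (g * v t) (map n (residual R star t) w) := by
  simp [push, cellLift_cell, hg]

/-- Along the steps from `g`, the directions `o` behave like residuals. -/
structure Compatible (v : S → G) (star : S → S → S) (o : G → Option S) (g : G) : Prop where
  of_none : o g = none → ∀ a, o (g * v a) = none
  of_some_self : ∀ t, o g = some t → o (g * v t) = none
  of_some_of_ne : ∀ t, o g = some t → ∀ a, a ≠ t → o (g * v a) = some (star a t)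

variable [Fintype S]

theorem d_homotopy_zero (g : G) (w : ⋀[R]^0 (S →₀ R)) :
    d v star 0 (homotopy o 0 (cell g w)) = cell g w - push v star o 0 (cell g w) := by
  cases hg : o g with
  | none => rw [homotopy_cell_none hg, push_cell_none hg, map_zero, sub_self]
  | some t =>
    rw [homotopy_cell_some hg, push_cell_some hg, d_cell, contract_wedge_zero, coordSum_single,
      one_smul, Finset.sum_eq_single t]
    · rw [contract_wedge_zero]
      simp
    · intro b _ hb
      rw [contract_wedge_zero]
      simp [Ne.symm hb]
    · simp

/-- Compatibility makes the homotopy commute with passage to far faces. What remains is the Leibniz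
rule `contract_wedge`: the near part returns the cell itself, and the far part in direction `t`
returns its push. -/
theorem d_homotopy_succ (n : ℕ) {g : G} (hc : Compatible v star o g)
    (w : ⋀[R]^(n + 1) (S →₀ R)) :
    d v star (n + 1) (homotopy o (n + 1) (cell g w)) +
        homotopy o n (d v star n (cell g w)) =
      cell g w - push v star o (n + 1) (cell g w) := by
  cases hg : o g with
  | none =>
    rw [homotopy_cell_none hg, push_cell_none hg, map_zero, sub_self, zero_add, d_cell, map_sub,
      map_sum, homotopy_cell_none hg, zero_sub, neg_eq_zero]
    exact Finset.sum_eq_zero fun a _ => homotopy_cell_none (hc.of_none hg a) _ _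
  | some t =>
    have h1 : ∀ a, homotopy o n (cell (g * v a)
        (map n (residual R star a) (contract (Finsupp.lapply a) n w))) =
        cell (g * v a) (map (n + 1) (residual R star a) (wedge (Finsupp.single t 1) n
          (contract (Finsupp.lapply a) n w))) := by
      intro a
      -- For `a = t` both sides vanish: no direction is left to add at `g * v t`, and the residual
      -- kills `t`.
      by_cases ha : a = t
      · subst ha
        rw [homotopy_cell_none (hc.of_some_self a hg), map_wedge, residual_single_self]
        have : ∀ x : ⋀[R]^n (S →₀ R), wedge (0 : S →₀ R) n x = 0 := fun x =>
          Subtype.ext (by rw [coe_wedge]; simp)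
        rw [this, map_zero]
      · rw [homotopy_cell_some (hc.of_some_of_ne t hg a ha), map_wedge,
          residual_single R star (Ne.symm ha)]
    have h2 : ∑ a, cell (g * v a) (map (n + 1) (residual R star a)
        ((Finsupp.lapply a : Module.Dual R (S →₀ R)) (Finsupp.single t 1) • w)) =
        (cell (g * v t) (map (n + 1) (residual R star t) w) : Chains R G S (n + 1)) := by
      rw [Finset.sum_eq_single t]
      · simp
      · intro b _ hb
        simp [Ne.symm hb]
      · simp
    rw [homotopy_cell_some hg, push_cell_some hg, d_cell, d_cell, map_sub, map_sum,
      homotopy_cell_some hg]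
    simp only [h1, contract_wedge, coordSum_single, one_smul, map_sub, Finset.sum_sub_distrib,
      h2]
    abel

end CubeComplex

/-! ### Left divisibility and acyclicity of the cube complex. -/

/-- Left divisibility in a group, with respect to a submonoid. -/
def LeftLe {G : Type*} [Group G] (P : Submonoid G) (x y : G) : Prop := x⁻¹ * y ∈ P

namespace LeftLe

variable {G : Type*} [Group G] {P : Submonoid G}

theorem refl (x : G) : LeftLe P x x := by simp [LeftLe]

theorem trans {x y z : G} (h : LeftLe P x y) (h' : LeftLe P y z) : LeftLe P x z := by
  simpa [LeftLe, mul_assoc] using P.mul_mem h h'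

theorem mul_right (x : G) {p : G} (hp : p ∈ P) : LeftLe P x (x * p) := by
  simpa [LeftLe] using hp

theorem mul_left_iff (g x y : G) : LeftLe P (g * x) (g * y) ↔ LeftLe P x y := by
  simp [LeftLe, mul_assoc]

end LeftLe

namespace CubeComplex
open exteriorPower

variable {R : Type*} [CommRing R] {G : Type*} [Group G] {S : Type*}

/-- A residual on a finite generating set of a submonoid `P` whose left divisibility order is
directed in both directions, together with the joins with each step `y ≤ y * v s`. -/
structure IsResidualSystem [DecidableEq S] (P : Submonoid G) (v : S → G) (star : S → S → S) :
    Prop extends IsCubical v star where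
  closure_range : Submonoid.closure (Set.range v) = P
  eq_one : ∀ p ∈ P, p⁻¹ ∈ P → p = 1
  ne_one : ∀ a, v a ≠ 1
  exists_le : ∀ x y, ∃ z, LeftLe P z x ∧ LeftLe P z y
  exists_ge : ∀ x y, ∃ z, LeftLe P x z ∧ LeftLe P y z
  -- Here `o g` is the generator `t` for which `g * v t` is the join of `g` and `y * v s`, or `none`
  -- if `g` already lies above `y * v s`. Nothing is asked of `o` outside `g ≥ y`.
  exists_step : ∀ y s, ∃ o : G → Option S, ∀ g, LeftLe P y g → Compatible v star o g ∧
    (o g = none → LeftLe P (y * v s) g) ∧ ∀ t, o g = some t → LeftLe P (y * v s) (g * v t) ∧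
      ∀ z, LeftLe P g z → LeftLe P (y * v s) z → LeftLe P (g * v t) z ∧
        ∀ a, a ≠ t → LeftLe P (g * v a) z → LeftLe P (g * v t * v (star t a)) z

variable (R) in
/-- The chains spanned by the cells at elements `g ≥ y` all of whose edges are bounded by `z`. -/
noncomputable def boundedChains (P : Submonoid G) (v : S → G) (n : ℕ) (y z : G) :
    Submodule R (Chains R G S n) :=
  Submodule.span R {c | ∃ (g : G) (a : Fin n → S), LeftLe P y g ∧ LeftLe P g z ∧
    (∀ i, LeftLe P (g * v (a i)) z) ∧ c = cell g (ιMulti R n fun i => Finsupp.single (a i) 1)}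

variable {P : Submonoid G} {v : S → G}

theorem boundedChains_mono (n : ℕ) {y z y' z' : G} (hy : LeftLe P y' y) (hz : LeftLe P z z') :
    boundedChains R P v n y z ≤ boundedChains R P v n y' z' := by
  refine Submodule.span_mono ?_
  rintro c ⟨g, a, h1, h2, h3, rfl⟩
  exact ⟨g, a, hy.trans h1, h2.trans hz, fun i => (h3 i).trans hz, rfl⟩

theorem span_cell_ιMulti_single (n : ℕ) :
    Submodule.span R {c : Chains R G S n | ∃ (g : G) (a : Fin n → S),
      c = cell g (ιMulti R n fun i => Finsupp.single (a i) 1)} = ⊤ := by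
  rw [eq_top_iff]
  rintro c -
  induction c using cell_induction with
  | h0 => exact zero_mem _
  | hadd a b ha hb => exact add_mem ha hb
  | hcell g w =>
    have hw : w ∈ Submodule.span R (ιMulti R n '' {a | Set.range a ⊆
        Set.range fun s : S => (Finsupp.single s 1 : S →₀ R)}) := by
      rw [ιMulti_span_of_span R n (S →₀ R)]
      · trivial
      · have := (Finsupp.basisSingleOne (R := R) (ι := S)).span_eq
        rwa [Finsupp.coe_basisSingleOne] at this
    induction hw using Submodule.span_induction with
    | mem x h =>
      obtain ⟨m, hm, rfl⟩ := h
      have : ∀ i, ∃ s : S, (Finsupp.single s 1 : S →₀ R) = m i := fun i => hm ⟨i, rfl⟩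
      choose a ha using this
      refine Submodule.subset_span ⟨g, a, ?_⟩
      simp only [ha]
    | zero => rw [map_zero]; exact zero_mem _
    | add x y _ _ hx hy => rw [map_add]; exact add_mem hx hy
    | smul r x _ hx => rw [map_smul]; exact Submodule.smul_mem _ _ hx

theorem boundedChains_succ_self (h1 : ∀ p ∈ P, p⁻¹ ∈ P → p = 1) (hv : ∀ a, v a ∈ P)
    (hv1 : ∀ a, v a ≠ 1) (n : ℕ) (y : G) :
    boundedChains R P v (n + 1) y y = ⊥ := by
  rw [boundedChains, Submodule.span_eq_bot]
  rintro c ⟨g, a, hg1, hg2, ha, -⟩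
  have hg : y⁻¹ * g = 1 := h1 _ hg1 (by simpa [LeftLe] using hg2)
  have hg : g = y := (inv_mul_eq_one.1 hg).symm
  subst hg
  have := ha 0
  refine absurd (h1 (v (a 0)) (hv _) ?_) (hv1 _)
  simpa [LeftLe, mul_assoc] using this

theorem boundedChains_zero_self (h1 : ∀ p ∈ P, p⁻¹ ∈ P → p = 1) (y : G)
    (c : Chains R G S 0) (hc : c ∈ boundedChains R P v 0 y y) :
    ∃ r : R, c = r • cell y ((zeroEquiv R (S →₀ R)).symm 1) := by
  induction hc using Submodule.span_induction with
  | mem x h =>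
    obtain ⟨g, a, hg1, hg2, -, rfl⟩ := h
    have hg : y⁻¹ * g = 1 := h1 _ hg1 (by simpa [LeftLe] using hg2)
    have hg : g = y := (inv_mul_eq_one.1 hg).symm
    subst hg
    refine ⟨1, ?_⟩
    rw [one_smul]
    congr 1
    rw [LinearEquiv.eq_symm_apply, zeroEquiv_ιMulti]
  | zero => exact ⟨0, by simp⟩
  | add x y _ _ hx hy =>
    obtain ⟨r, rfl⟩ := hx
    obtain ⟨s, rfl⟩ := hy
    exact ⟨r + s, by rw [add_smul]⟩
  | smul r x _ hx =>
    obtain ⟨s, rfl⟩ := hx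
    exact ⟨r * s, by rw [mul_smul]⟩

variable [DecidableEq S] {star : S → S → S}

namespace IsResidualSystem

theorem mem (h : IsResidualSystem P v star) (a : S) : v a ∈ P := by
  rw [← h.closure_range]; exact Submonoid.subset_closure ⟨a, rfl⟩

theorem exists_ge_finset (h : IsResidualSystem P v star) (F : Finset G) :
    ∃ z, ∀ x ∈ F, LeftLe P x z := by
  classical
  induction F using Finset.induction_on with
  | empty => exact ⟨1, by simp⟩
  | insert x F _ ih =>
    obtain ⟨z, hz⟩ := ih
    obtain ⟨z', h1, h2⟩ := h.exists_ge x z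
    refine ⟨z', fun w hw => ?_⟩
    rcases Finset.mem_insert.1 hw with rfl | hw
    · exact h1
    · exact (hz w hw).trans h2

/-- A chain involves finitely many cells, so directedness downwards and upwards supplies `y` and
`z`. -/
theorem exists_mem_boundedChains (h : IsResidualSystem P v star) (n : ℕ) (c : Chains R G S n) :
    ∃ y z, LeftLe P y z ∧ c ∈ boundedChains R P v n y z := by
  classical
  have hc : c ∈ Submodule.span R {c : Chains R G S n | ∃ (g : G) (a : Fin n → S),
      c = cell g (ιMulti R n fun i => Finsupp.single (a i) 1)} := by
    rw [span_cell_ιMulti_single]; trivial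
  induction hc using Submodule.span_induction with
  | mem x hx =>
    obtain ⟨g, a, rfl⟩ := hx
    obtain ⟨z, hz⟩ := h.exists_ge_finset (insert g (Finset.univ.image fun i => g * v (a i)))
    have hg := hz g (Finset.mem_insert_self _ _)
    exact ⟨g, z, hg, Submodule.subset_span ⟨g, a, LeftLe.refl g, hg,
      fun i => hz _ (Finset.mem_insert_of_mem (Finset.mem_image_of_mem _ (Finset.mem_univ i))),
      rfl⟩⟩
  | zero => exact ⟨1, 1, LeftLe.refl 1, zero_mem _⟩
  | add x x' _ _ hx hx' =>
    obtain ⟨y, z, hyz, hx⟩ := hx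
    obtain ⟨y', z', hyz', hx'⟩ := hx'
    obtain ⟨y₀, h1, h2⟩ := h.exists_le y y'
    obtain ⟨z₀, h3, h4⟩ := h.exists_ge z z'
    exact ⟨y₀, z₀, (h1.trans hyz).trans h3,
      add_mem (boundedChains_mono n h1 h3 hx) (boundedChains_mono n h2 h4 hx')⟩
  | smul r x _ hx =>
    obtain ⟨y, z, hyz, hx⟩ := hx
    exact ⟨y, z, hyz, Submodule.smul_mem _ _ hx⟩

/-- One step of the contraction of the bounded chains to their upper bound. -/
theorem exists_homotopy [Fintype S] (h : IsResidualSystem P v star) (y : G) (s : S) :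
    ∃ (H : ∀ n, Chains R G S n →ₗ[R] Chains R G S (n + 1))
      (J : ∀ n, Chains R G S n →ₗ[R] Chains R G S n),
      (∀ n z, LeftLe P (y * v s) z → ∀ c ∈ boundedChains R P v n y z,
        J n c ∈ boundedChains R P v n (y * v s) z) ∧
      (∀ z, ∀ c ∈ boundedChains R P v 0 y z, d v star 0 (H 0 c) = c - J 0 c) ∧
      ∀ n z, ∀ c ∈ boundedChains R P v (n + 1) y z,
        d v star (n + 1) (H (n + 1) c) + H n (d v star n c) = c - J (n + 1) c := by
  obtain ⟨o, ho⟩ := h.exists_step y s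
  refine ⟨homotopy o, push v star o, fun n z hz c hc => ?_, fun z c hc => ?_,
    fun n z c hc => ?_⟩
  · induction hc using Submodule.span_induction with
    | mem x hx =>
      obtain ⟨g, a, hg1, hg2, ha, rfl⟩ := hx
      obtain ⟨-, h1, h2⟩ := ho g hg1
      cases hg : o g with
      | none =>
        rw [push_cell_none hg]
        exact Submodule.subset_span ⟨g, a, h1 hg, hg2, ha, rfl⟩
      | some t =>
        obtain ⟨h3, h4⟩ := h2 t hg
        obtain ⟨h5, h6⟩ := h4 z hg2 hz
        rw [push_cell_some hg, map_apply_ιMulti]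
        -- A cube containing the direction `t` is flattened by the push and becomes zero.
        by_cases hat : ∃ i, a i = t
        · obtain ⟨i, hi⟩ := hat
          rw [(ιMulti R n).map_coord_zero i, map_zero]
          · exact zero_mem _
          · simp [hi, residual_single_self]
        · push Not at hat
          refine Submodule.subset_span ⟨g * v t, fun i => star t (a i), h3, h5,
            fun i => h6 (a i) (hat i) (ha i), ?_⟩
          congr 2
          funext i
          exact residual_single R star (hat i)
    | zero => rw [map_zero]; exact zero_mem _
    | add x y _ _ hx hy => rw [map_add]; exact add_mem hx hy
    | smul r x _ hx => rw [map_smul]; exact Submodule.smul_mem _ _ hx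
  · induction hc using Submodule.span_induction with
    | mem x hx =>
      obtain ⟨g, a, -, -, -, rfl⟩ := hx
      exact d_homotopy_zero g _
    | zero => simp
    | add x y _ _ hx hy => rw [map_add, map_add, hx, hy, map_add]; abel
    | smul r x _ hx =>
      rw [map_smul, LinearMap.map_smul_of_tower, hx, map_smul, smul_sub]
  · induction hc using Submodule.span_induction with
    | mem x hx =>
      obtain ⟨g, a, hg, -, -, rfl⟩ := hx
      exact d_homotopy_succ n (ho g hg).1 _
    | zero => simp
    | add x y _ _ hx hy =>
      rw [map_add, map_add, map_add, map_add, map_add, add_add_add_comm, hx, hy]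
      abel
    | smul r x _ hx =>
      rw [map_smul, LinearMap.map_smul_of_tower, LinearMap.map_smul_of_tower, map_smul, map_smul,
        ← smul_add, hx, smul_sub]

/-- A cycle differs from its push by a boundary, and the push is a cycle with the same upper bound
`z` and the larger lower bound `y * v s`. When the bounds meet, no cell of positive dimension
remains. -/
theorem exists_d_eq [Fintype S] (h : IsResidualSystem P v star) (n : ℕ)
    (c : Chains R G S (n + 1)) (hc : d v star n c = 0) : ∃ e, d v star (n + 1) e = c := by
  obtain ⟨y, z, hyz, hcm⟩ := h.exists_mem_boundedChains (n + 1) c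
  obtain ⟨p, hp, rfl⟩ : ∃ p ∈ P, z = y * p := ⟨_, hyz, by simp⟩
  clear hyz
  rw [← h.closure_range] at hp
  induction hp using Submonoid.closure_induction_left generalizing y c with
  | one =>
    rw [mul_one, boundedChains_succ_self h.eq_one h.mem h.ne_one, Submodule.mem_bot] at hcm
    exact ⟨0, by rw [hcm, map_zero]⟩
  | mul_left x hx q hq ih =>
    obtain ⟨s, rfl⟩ := hx
    rw [← mul_assoc] at hcm
    rw [h.closure_range] at hq
    obtain ⟨H, J, hJ, -, hH⟩ := h.exists_homotopy (R := R) y s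
    have h1 := hH n _ c hcm
    rw [hc, map_zero, add_zero] at h1
    have h2 : d v star n (J (n + 1) c) = 0 := by
      have h3 := d_d h.toIsCubical n (H (n + 1) c)
      rwa [h1, map_sub, hc, zero_sub, neg_eq_zero] at h3
    obtain ⟨e, he⟩ := ih (J (n + 1) c) h2 (y * v s) (hJ _ _ (LeftLe.mul_right _ hq) c hcm)
    exact ⟨e + H (n + 1) c, by rw [map_add, he, h1]; abel⟩

theorem exists_sub_d_eq [Fintype S] (h : IsResidualSystem P v star) (c : Chains R G S 0) :
    ∃ e g, ∃ r : R, c - d v star 0 e = r • cell g ((zeroEquiv R (S →₀ R)).symm 1) := by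
  obtain ⟨y, z, hyz, hcm⟩ := h.exists_mem_boundedChains 0 c
  obtain ⟨p, hp, rfl⟩ : ∃ p ∈ P, z = y * p := ⟨_, hyz, by simp⟩
  clear hyz
  rw [← h.closure_range] at hp
  induction hp using Submonoid.closure_induction_left generalizing y c with
  | one =>
    rw [mul_one] at hcm
    obtain ⟨r, hr⟩ := boundedChains_zero_self h.eq_one y c hcm
    exact ⟨0, y, r, by rw [map_zero, sub_zero, hr]⟩
  | mul_left x hx q hq ih =>
    obtain ⟨s, rfl⟩ := hx
    rw [← mul_assoc] at hcm
    rw [h.closure_range] at hq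
    obtain ⟨H, J, hJ, hH, -⟩ := h.exists_homotopy (R := R) y s
    obtain ⟨e, g, r, he⟩ := ih (J 0 c) (y * v s) (hJ _ _ (LeftLe.mul_right _ hq) c hcm)
    refine ⟨e + H 0 c, g, r, ?_⟩
    rw [← he, map_add, hH _ c hcm]
    abel

end IsResidualSystem

/-! ### The augmentation and exactness in degree zero. -/

section Augmentation

variable {N : Type*} [AddCommGroup N] [Module R N] [Module R[G] N] [IsScalarTower R R[G] N]

variable (S) in
/-- The augmentation of the cube complex. -/
noncomputable def augmentation (e : R ≃ₗ[R] N) : Chains R G S 0 →ₗ[R[G]] N :=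
  equivariantLift (e.toLinearMap ∘ₗ (zeroEquiv R (S →₀ R)).toLinearMap)

variable {e : R ≃ₗ[R] N} (he : ∀ (g : G) (x : N), MonoidAlgebra.of R G g • x = x)
include he

omit [DecidableEq S] in
theorem augmentation_cell (g : G) (w : ⋀[R]^0 (S →₀ R)) :
    augmentation S e (cell g w) = e (zeroEquiv R (S →₀ R) w) := by
  rw [augmentation, equivariantLift_cell, he]
  rfl

omit [DecidableEq S] in
theorem augmentation_surjective : Function.Surjective (augmentation (G := G) S e) := fun x =>
  ⟨cell 1 ((zeroEquiv R (S →₀ R)).symm (e.symm x)), by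
    rw [augmentation_cell he, LinearEquiv.apply_symm_apply, LinearEquiv.apply_symm_apply]⟩

variable [Fintype S]

/-- Residuals act trivially on `⋀⁰`, so the near and far vertices have equal augmentations. -/
theorem augmentation_d (c : Chains R G S 1) : augmentation S e (d v star 0 c) = 0 := by
  induction c using cell_induction with
  | h0 => simp
  | hadd a b ha hb => rw [map_add, map_add, ha, hb, add_zero]
  | hcell g w =>
    have h1 : ∀ (f : (S →₀ R) →ₗ[R] S →₀ R) (x : ⋀[R]^0 (S →₀ R)), map 0 f x = x := by
      intro f x
      apply (zeroEquiv R (S →₀ R)).injective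
      exact LinearMap.congr_fun (zeroEquiv_naturality f) x
    simp only [d_cell, map_sub, map_sum, augmentation_cell he, h1]
    rw [coordSum, contract_sum, map_sum, map_sum, sub_self]

theorem IsResidualSystem.exists_d_eq_of_augmentation_eq_zero (h : IsResidualSystem P v star)
    (c : Chains R G S 0) (hc : augmentation S e c = 0) : ∃ x, d v star 0 x = c := by
  obtain ⟨x, g, r, hx⟩ := h.exists_sub_d_eq c
  have h0 := congrArg (augmentation S e) hx
  rw [map_sub, hc, augmentation_d he, sub_zero, LinearMap.map_smul_of_tower, augmentation_cell he,
    LinearEquiv.apply_symm_apply, ← map_smul, smul_eq_mul, mul_one, eq_comm,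
    LinearEquiv.map_eq_zero_iff] at h0
  rw [h0, zero_smul, sub_eq_zero] at hx
  exact ⟨x, hx.symm⟩

end Augmentation

end CubeComplex

/-! ### From the hypotheses on `P` to a residual system. -/

/-- `z` is the least upper bound of `x` and `y` with respect to left divisibility. -/
def IsLeftJoin {G : Type*} [Group G] (P : Submonoid G) (x y z : G) : Prop :=
  ∀ w, LeftLe P x w ∧ LeftLe P y w ↔ LeftLe P z w

section

open CubeComplex

variable {G : Type*} [Group G] {P : Submonoid G}

theorem mem_smul_iff_leftLe (x w : G) : w ∈ x • (P : Set G) ↔ LeftLe P x w := by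
  rw [Set.mem_smul_set_iff_inv_smul_mem]; rfl

theorem isLeftJoin_iff (x y z : G) :
    IsLeftJoin P x y z ↔ x • (P : Set G) ∩ y • (P : Set G) = z • (P : Set G) := by
  simp only [IsLeftJoin, Set.ext_iff, Set.mem_inter_iff, mem_smul_iff_leftLe]

theorem LeftLe.antisymm (h1 : ∀ p ∈ P, p⁻¹ ∈ P → p = 1) {x y : G} (h : LeftLe P x y)
    (h' : LeftLe P y x) : x = y :=
  inv_mul_eq_one.1 (h1 _ h (by simpa [LeftLe] using h'))

namespace IsLeftJoin

variable {x y z : G}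

theorem left (h : IsLeftJoin P x y z) : LeftLe P x z := ((h z).2 (LeftLe.refl z)).1

theorem right (h : IsLeftJoin P x y z) : LeftLe P y z := ((h z).2 (LeftLe.refl z)).2

theorem le (h : IsLeftJoin P x y z) {w : G} (hx : LeftLe P x w) (hy : LeftLe P y w) :
    LeftLe P z w := (h w).1 ⟨hx, hy⟩

theorem symm (h : IsLeftJoin P x y z) : IsLeftJoin P y x z := fun w => and_comm.trans (h w)

theorem of_le (h : LeftLe P x y) : IsLeftJoin P x y y := fun _ =>
  ⟨fun hw => hw.2, fun hw => ⟨h.trans hw, hw⟩⟩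

theorem unique (h1 : ∀ p ∈ P, p⁻¹ ∈ P → p = 1) {z' : G} (h : IsLeftJoin P x y z)
    (h' : IsLeftJoin P x y z') : z = z' :=
  LeftLe.antisymm h1 (h.le h'.left h'.right) (h'.le h.left h.right)

theorem mul_left (g : G) (h : IsLeftJoin P x y z) : IsLeftJoin P (g * x) (g * y) (g * z) := by
  intro w
  obtain ⟨w, rfl⟩ : ∃ w', w = g * w' := ⟨g⁻¹ * w, by simp⟩
  simpa only [LeftLe.mul_left_iff] using h w

end IsLeftJoin

/-- A finite set of generators of a submonoid whose left divisibility order is a join semilattice,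
such that joins with a generator step are generator steps, and no generator is bounded by the join
of two others. -/
structure IsLatticeGenerating (P : Submonoid G) (S : Finset G) : Prop where
  closure_eq : Submonoid.closure (S : Set G) = P
  eq_one : ∀ p ∈ P, p⁻¹ ∈ P → p = 1
  ne_one : ∀ s ∈ S, s ≠ 1
  exists_fraction : ∀ g : G, ∃ p ∈ P, ∃ q ∈ P, g = p * q⁻¹
  exists_join : ∀ x y, ∃ z, IsLeftJoin P x y z
  join_step : ∀ x y z, IsLeftJoin P x y z → ∀ s ∈ S, IsLeftJoin P (x * s) y z ∨
    ∃ t ∈ S, IsLeftJoin P (x * s) y (z * t)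
  not_le : ∀ s ∈ S, ∀ t ∈ S, s ≠ t → ¬ LeftLe P s t
  not_le_join : ∀ a ∈ S, ∀ b ∈ S, ∀ c ∈ S, b ≠ a → b ≠ c → ∀ z, IsLeftJoin P a c z →
    ¬ LeftLe P b z

namespace IsLatticeGenerating

variable {S : Finset G} (h : IsLatticeGenerating P S)
include h

theorem mem {s : G} (hs : s ∈ S) : s ∈ P := by
  rw [← h.closure_eq]; exact Submonoid.subset_closure hs

/-- Since `1 ∨ a = a`, replacing `1` by the step `c` either leaves the join at `a`, which would give
`c ≤ a`, or moves it to some `a * t`. The value on the diagonal is arbitrary. -/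
theorem exists_residual : ∃ star : S → S → S, ∀ a c : S, a ≠ c →
    IsLeftJoin P (c : G) a (a * star a c) := by
  have : ∀ a c : S, ∃ t : S, a ≠ c → IsLeftJoin P (c : G) a (a * t) := by
    intro a c
    by_cases hac : a = c
    · exact ⟨a, fun h => absurd hac h⟩
    · have h1 : IsLeftJoin P (1 : G) a a :=
        IsLeftJoin.of_le (by simpa [LeftLe] using h.mem a.2)
      rcases h.join_step 1 a a h1 c c.2 with h2 | ⟨t, ht, h2⟩
      · rw [one_mul] at h2
        exact absurd h2.left (h.not_le c c.2 a a.2 fun e => hac (Subtype.ext e.symm))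
      · rw [one_mul] at h2
        exact ⟨⟨t, ht⟩, fun _ => h2⟩
  choose star hstar using this
  exact ⟨star, hstar⟩

variable {star : S → S → S}
  (hstar : ∀ a c : S, a ≠ c → IsLeftJoin P (c : G) a (a * star a c))
include hstar

/-- If `star a b = star a c`, then `a ∨ b = a ∨ c` lies above `c`, which forces `b = c`. Both sides
of `star_star` arise from the join of `a`, `b`, `c` by cancelling the same factor `a ∨ c`. -/
theorem isCubical : IsCubical (fun s : S => (s : G)) star := by
  have hinj : ∀ a b c : S, b ≠ a → c ≠ a → star a b = star a c → b = c := by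
    intro a b c hb hc e
    by_contra hbc
    have h1 := hstar a b (Ne.symm hb)
    rw [e] at h1
    exact h.not_le_join c c.2 b b.2 a a.2 (fun e => hbc (Subtype.ext e))
      (fun e => hb (Subtype.ext e)) _ (hstar a c (Ne.symm hc)) h1.left
  refine ⟨fun a c hac => (hstar a c hac).unique h.eq_one (hstar c a (Ne.symm hac)).symm, hinj, ?_⟩
  have key : ∀ a b c : S, a ≠ b → b ≠ c → a ≠ c → ∀ w,
      LeftLe P (a * star a c * star (star a c) (star a b) : G) w ↔
        LeftLe P (a : G) w ∧ LeftLe P (b : G) w ∧ LeftLe P (c : G) w := by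
    intro a b c hab hbc hac w
    have hne : star a c ≠ star a b := fun e => hbc (hinj a c b (Ne.symm hac) (Ne.symm hab) e).symm
    have h1 := (hstar _ _ hne).mul_left (a : G)
    rw [mul_assoc, ← h1 w, ← hstar a b hab w, ← hstar a c hac w]
    tauto
  intro a b c hab hbc hac
  have h1 : (a * star a c * star (star a c) (star a b) : G) =
      c * star c a * star (star c a) (star c b) := by
    have h2 := key a b c hab hbc hac
    have h3 := key c b a (Ne.symm hbc) (Ne.symm hab) (Ne.symm hac)
    refine LeftLe.antisymm h.eq_one ((h2 _).2 ?_) ((h3 _).2 ?_)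
    · have := (h3 _).1 (LeftLe.refl _); tauto
    · have := (h2 _).1 (LeftLe.refl _); tauto
  rw [(hstar a c hac).unique h.eq_one (hstar c a (Ne.symm hac)).symm] at h1
  exact Subtype.ext (mul_left_cancel h1)

theorem exists_step (y : G) (s : S) : ∃ o : G → Option S, ∀ g, LeftLe P y g →
    Compatible (fun s : S => (s : G)) star o g ∧ (o g = none → LeftLe P (y * s) g) ∧
    ∀ t, o g = some t → LeftLe P (y * s) (g * t) ∧
      ∀ z, LeftLe P g z → LeftLe P (y * s) z → LeftLe P (g * t) z ∧
        ∀ a, a ≠ t → LeftLe P (g * a) z → LeftLe P (g * t * star t a) z := by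
  classical
  let o : G → Option S := fun g => if H : ∃ t : S, IsLeftJoin P (y * s) g (g * t) then
    some H.choose else none
  have ho : ∀ {g t}, o g = some t → IsLeftJoin P (y * s) g (g * t) := by
    intro g t ht
    by_cases H : ∃ t : S, IsLeftJoin P (y * s) g (g * t)
    · simp only [o, dif_pos H, Option.some.injEq] at ht
      rw [← ht]
      exact H.choose_spec
    · simp only [o, dif_neg H] at ht
      exact absurd ht (by simp)
  have ho' : ∀ {g : G} {t : S}, IsLeftJoin P (y * s) g (g * t) → o g = some t := by
    intro g t ht
    have H : ∃ t : S, IsLeftJoin P (y * s) g (g * t) := ⟨t, ht⟩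
    simp only [o, dif_pos H, Option.some.injEq]
    exact Subtype.ext (mul_left_cancel (H.choose_spec.unique h.eq_one ht))
  have hnone : ∀ {g}, LeftLe P (y * s) g → o g = none := by
    intro g hg
    cases ht : o g with
    | none => rfl
    | some t =>
      have h1 := (ho ht).unique h.eq_one (IsLeftJoin.of_le hg)
      exact absurd (mul_eq_left.1 h1) (h.ne_one t t.2)
  have hnone' : ∀ {g}, LeftLe P y g → o g = none → LeftLe P (y * s) g := by
    intro g hg hn
    rcases h.join_step y g g (IsLeftJoin.of_le hg) s s.2 with h1 | ⟨t, ht, h1⟩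
    · exact h1.left
    · rw [ho' (t := ⟨t, ht⟩) h1] at hn
      exact absurd hn (by simp)
  refine ⟨o, fun g hg => ⟨⟨fun hn a => ?_, fun t ht => hnone (ho ht).left,
    fun t ht a hat => ho' fun w => ?_⟩, hnone' hg, fun t ht => ⟨(ho ht).left,
    fun z hgz hsz => ⟨(ho ht).le hsz hgz, fun a hat haz => ?_⟩⟩⟩⟩
  · exact hnone ((hnone' hg hn).trans (LeftLe.mul_right g (h.mem a.2)))
  -- The join of `y * s` and `g * a` equals that of `g * t` and `g * a`, since `g ≤ g * a`.
  · have h1 := (hstar a t hat).mul_left g w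
    rw [mul_assoc, ← h1, ← ho ht w]
    have h2 : LeftLe P (g * a) w → LeftLe P g w :=
      (LeftLe.mul_right g (h.mem a.2)).trans
    tauto
  · rw [mul_assoc]
    exact ((hstar t a (Ne.symm hat)).mul_left g).le haz ((ho ht).le hsz hgz)

/-- The join of all generators conjugates each generator into a generator. -/
theorem exists_garside : ∃ D ∈ P, (∀ a ∈ S, LeftLe P a D) ∧
    ∀ a ∈ S, ∃ t ∈ S, a * D = D * t := by
  classical
  -- Including `1` among the joined elements handles empty `F` and puts `D` in `P`.
  have hF : ∀ F : Finset G, ∃ D, ∀ w, LeftLe P D w ↔ LeftLe P 1 w ∧ ∀ a ∈ F, LeftLe P a w := by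
    intro F
    induction F using Finset.induction_on with
    | empty => exact ⟨1, fun w => by simp⟩
    | insert x F _ ih =>
      obtain ⟨D, hD⟩ := ih
      obtain ⟨z, hz⟩ := h.exists_join x D
      refine ⟨z, fun w => ?_⟩
      rw [← hz w, hD w]
      simp only [Finset.mem_insert, forall_eq_or_imp]
      tauto
  obtain ⟨D, hD⟩ := hF S
  have hDD := (hD D).1 (LeftLe.refl D)
  refine ⟨D, by simpa [LeftLe] using hDD.1, hDD.2, fun a ha => ?_⟩
  -- The residuals along `a` of the other generators are distinct, so they miss exactly one
  -- generator `s₀`.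
  obtain ⟨s₀, hs₀⟩ : ∃ s₀ : S, ∀ s : S, s = s₀ ∨ ∃ c : S, c ≠ ⟨a, ha⟩ ∧ star ⟨a, ha⟩ c = s := by
    let a' : S := ⟨a, ha⟩
    let I := (Finset.univ.erase a').image (star a')
    have hI : I.card = Fintype.card S - 1 := by
      rw [Finset.card_image_of_injOn, Finset.card_erase_of_mem (Finset.mem_univ _),
        Finset.card_univ]
      intro b hb c hc e
      exact (h.isCubical hstar).star_injective a' b c (by simpa using hb) (by simpa using hc) e
    have hpos : 0 < Fintype.card S := Fintype.card_pos_iff.2 ⟨a'⟩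
    obtain ⟨s₀, hs₀⟩ : ∃ s₀, s₀ ∉ I := by
      by_contra! hall
      have : I = Finset.univ := Finset.eq_univ_of_forall hall
      rw [this, Finset.card_univ] at hI
      omega
    have hins : insert s₀ I = Finset.univ := by
      apply Finset.eq_univ_of_card
      rw [Finset.card_insert_of_notMem hs₀, hI]
      omega
    refine ⟨s₀, fun s => ?_⟩
    have hs : s ∈ insert s₀ I := by rw [hins]; exact Finset.mem_univ s
    rcases Finset.mem_insert.1 hs with hs | hs
    · exact Or.inl hs
    · obtain ⟨c, hc, hcs⟩ := Finset.mem_image.1 hs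
      exact Or.inr ⟨c, Finset.ne_of_mem_erase hc, hcs⟩
  -- `a * D` is the join of `a` and all `a * s`. For `s ≠ s₀` these are the joins `a ∨ c`, all below
  -- whatever bounds `D` and `a`; only `a * s₀` is new.
  have hjoin : IsLeftJoin P (a * s₀) D (a * D) := by
    intro w
    have h1 : LeftLe P (a * D) w ↔ LeftLe P a w ∧ ∀ s ∈ S, LeftLe P (a * s) w := by
      obtain ⟨w, rfl⟩ : ∃ w', w = a * w' := ⟨a⁻¹ * w, by simp⟩
      have h2 : LeftLe P a (a * w) ↔ LeftLe P 1 w := by simp [LeftLe]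
      simp only [LeftLe.mul_left_iff, h2, hD]
    have hal : LeftLe P (1 : G) a := by simpa [LeftLe] using h.mem ha
    rw [h1, hD w]
    constructor
    · rintro ⟨h2, -, h3⟩
      refine ⟨h3 a ha, fun s hs => ?_⟩
      rcases hs₀ ⟨s, hs⟩ with e | ⟨c, hc, e⟩
      · rw [show s = s₀ from congrArg Subtype.val e]; exact h2
      · rw [show s = star ⟨a, ha⟩ c from congrArg Subtype.val e.symm]
        exact (hstar ⟨a, ha⟩ c (Ne.symm hc)).le (h3 c c.2) (h3 a ha)
    · rintro ⟨h2, h3⟩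
      refine ⟨h3 _ s₀.2, hal.trans h2, fun s hs => ?_⟩
      by_cases hsa : (⟨a, ha⟩ : S) = ⟨s, hs⟩
      · rw [← show a = s from congrArg Subtype.val hsa]; exact h2
      · exact (hstar ⟨a, ha⟩ ⟨s, hs⟩ hsa).left.trans (h3 _ (star ⟨a, ha⟩ ⟨s, hs⟩).2)
  rcases h.join_step a D D (IsLeftJoin.of_le (hDD.2 a ha)) s₀ s₀.2 with h1 | ⟨t, ht, h1⟩
  · exact absurd (mul_eq_right.1 (hjoin.unique h.eq_one h1)) (h.ne_one a ha)
  · exact ⟨t, ht, hjoin.unique h.eq_one h1⟩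

/-- Conjugation by `D` permutes the generators, so every `q ∈ P` is a right divisor of a power of
`D`. Writing `x⁻¹y = p q⁻¹` with `D ^ k * q⁻¹ ∈ P` and moving `D ^ k` past `p` shows that `x * (D ^
k)⁻¹` lies below `y`. -/
theorem exists_common_lower_bound (x y : G) : ∃ z, LeftLe P z x ∧ LeftLe P z y := by
  obtain ⟨D, hDP, hDS, hconj⟩ := h.exists_garside hstar
  have hsurj : ∀ t ∈ S, ∃ a ∈ S, a * D = D * t := by
    have : ∀ a : S, ∃ t : S, a * D = D * t := fun a => by
      obtain ⟨t, ht, e⟩ := hconj a a.2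
      exact ⟨⟨t, ht⟩, e⟩
    choose τ hτ using this
    have hinj : Function.Injective τ := fun a b e =>
      Subtype.ext (mul_right_cancel ((hτ a).trans (e ▸ (hτ b).symm)))
    intro t ht
    obtain ⟨a, ha⟩ := Finite.surjective_of_injective hinj ⟨t, ht⟩
    exact ⟨a, a.2, by rw [hτ a, ha]⟩
  have hP : ∀ p ∈ P, ∃ p' ∈ P, p' * D = D * p := by
    intro p hp
    rw [← h.closure_eq] at hp
    induction hp using Submonoid.closure_induction with
    | mem t ht =>
      obtain ⟨a, ha, e⟩ := hsurj t ht
      exact ⟨a, h.mem ha, e⟩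
    | one => exact ⟨1, P.one_mem, by simp⟩
    | mul p q _ _ hp hq =>
      obtain ⟨p', hp', e⟩ := hp
      obtain ⟨q', hq', e'⟩ := hq
      exact ⟨p' * q', P.mul_mem hp' hq', by rw [mul_assoc, e', ← mul_assoc, e, mul_assoc]⟩
  have hpow : ∀ k : ℕ, ∀ p ∈ P, ∃ p' ∈ P, p' * D ^ k = D ^ k * p := by
    intro k
    induction k with
    | zero => exact fun p hp => ⟨p, hp, by simp⟩
    | succ k ih =>
      intro p hp
      obtain ⟨q, hq, e⟩ := hP p hp
      obtain ⟨r, hr, e'⟩ := ih q hq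
      exact ⟨r, hr, by rw [pow_succ, ← mul_assoc, e', mul_assoc, e, mul_assoc]⟩
  have hdiv : ∀ q ∈ P, ∃ k : ℕ, D ^ k * q⁻¹ ∈ P := by
    intro q hq
    rw [← h.closure_eq] at hq
    induction hq using Submonoid.closure_induction_left with
    | one => exact ⟨0, by simp⟩
    | mul_left t ht q _ ih =>
      obtain ⟨k, hk⟩ := ih
      obtain ⟨r, hr, e⟩ := hP _ hk
      obtain ⟨a, ha, e'⟩ := hsurj t ht
      refine ⟨k + 1, ?_⟩
      have h1 : D * t⁻¹ = a⁻¹ * D := by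
        rw [mul_inv_eq_iff_eq_mul, mul_assoc, ← e', inv_mul_cancel_left]
      have h2 : D ^ (k + 1) * (t * q)⁻¹ = r * (a⁻¹ * D) := by
        rw [← h1, ← mul_assoc, e, pow_succ', mul_inv_rev, mul_assoc, mul_assoc, mul_assoc]
      rw [h2]
      exact P.mul_mem hr (hDS a ha)
  obtain ⟨p, hp, q, hq, e⟩ := h.exists_fraction (x⁻¹ * y)
  obtain ⟨k, hk⟩ := hdiv q hq
  obtain ⟨r, hr, e'⟩ := hpow k p hp
  refine ⟨x * (D ^ k)⁻¹, ?_, ?_⟩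
  · simpa [LeftLe] using P.pow_mem hDP k
  · have h1 : (x * (D ^ k)⁻¹)⁻¹ * y = r * (D ^ k * q⁻¹) := by
      rw [← mul_assoc, e', mul_assoc, ← e]
      group
    rw [LeftLe, h1]
    exact P.mul_mem hr hk

theorem isResidualSystem [DecidableEq S] :
    IsResidualSystem P (fun s : S => (s : G)) star where
  toIsCubical := h.isCubical hstar
  closure_range := by
    refine Eq.trans ?_ h.closure_eq
    congr 1
    exact Subtype.range_coe
  eq_one := h.eq_one
  ne_one a := h.ne_one a a.2
  exists_le := h.exists_common_lower_bound hstar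
  exists_ge x y := by
    obtain ⟨z, hz⟩ := h.exists_join x y
    exact ⟨z, hz.left, hz.right⟩
  exists_step := h.exists_step hstar

end IsLatticeGenerating

theorem isLatticeGenerating {S : Finset G} {P : Submonoid G}
    (hS : Submonoid.closure (S : Set G) = P)
    (h1 : ∀ p ∈ P, p⁻¹ ∈ P → p = 1)
    (hj : ∀ x y : G, x • (P : Set G) ∩ y • (P : Set G) = ∅ ∨
      ∃ z : G, x • (P : Set G) ∩ y • (P : Set G) = z • (P : Set G))
    (henv : ∀ g : G, ∃ p ∈ P, ∃ q ∈ P, g = p * q⁻¹)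
    (hb : ∀ x y z : G, x • (P : Set G) ∩ y • (P : Set G) = z • (P : Set G) →
      ∀ s ∈ S, (x * s) • (P : Set G) ∩ y • (P : Set G) = z • (P : Set G) ∨
        ∃ t ∈ S, (x * s) • (P : Set G) ∩ y • (P : Set G) = (z * t) • (P : Set G))
    (hc : ∀ F : Finset G, F ⊆ S → ∀ s ∈ S, s ∉ F →
      s • (P : Set G) ∩ (⋂ t ∈ F, t • (P : Set G)) ⊂ ⋂ t ∈ F, t • (P : Set G)) :
    IsLatticeGenerating P S := by
  classical
  have hmem : ∀ s ∈ S, s ∈ P := fun s hs => by rw [← hS]; exact Submonoid.subset_closure hs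
  have hnot : ∀ F : Finset G, F ⊆ S → ∀ s ∈ S, s ∉ F →
      ¬ ∀ w, (∀ t ∈ F, LeftLe P t w) → LeftLe P s w := by
    intro F hF s hs hsF hall
    refine (hc F hF s hs hsF).2 fun w hw => ⟨?_, hw⟩
    rw [mem_smul_iff_leftLe]
    refine hall w fun t ht => ?_
    simp only [Set.mem_iInter, mem_smul_iff_leftLe] at hw
    exact hw t ht
  have hle : ∀ s ∈ S, ∀ t ∈ S, s ≠ t → ¬ LeftLe P s t := by
    intro s hs t ht hst hle
    refine hnot {t} (by simpa using ht) s hs (by simpa using hst) fun w hw => ?_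
    exact hle.trans (hw t (Finset.mem_singleton_self t))
  have hne : ∀ s ∈ S, s ≠ 1 := by
    -- If `1` were a generator, incomparability would make it the only one. Then `G` is trivial,
    -- against (c) for `F = ∅`.
    rintro s hs rfl
    have hS1 : ∀ t ∈ S, t = 1 := by
      intro t ht
      by_contra hne
      exact hle 1 hs t ht (Ne.symm hne) (by simpa [LeftLe] using hmem t ht)
    have hP1 : ∀ p ∈ P, p = 1 := by
      intro p hp
      rw [← hS] at hp
      induction hp using Submonoid.closure_induction with
      | mem t ht => exact hS1 t ht
      | one => rfl
      | mul p q _ _ hp hq => rw [hp, hq, one_mul]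
    refine hnot ∅ (by simp) 1 hs (by simp) fun w _ => ?_
    obtain ⟨p, hp, q, hq, rfl⟩ := henv w
    rw [hP1 p hp, hP1 q hq]
    simpa using LeftLe.refl (P := P) (1 : G)
  refine ⟨hS, h1, hne, henv, fun x y => ?_, fun x y z hz s hs => ?_, hle, ?_⟩
  · rcases hj x y with h | ⟨z, hz⟩
    · obtain ⟨p, hp, q, hq, e⟩ := henv (x⁻¹ * y)
      have e' : x * p = y * q := by
        rw [inv_mul_eq_iff_eq_mul] at e
        rw [e]; group
      have : x * p ∈ x • (P : Set G) ∩ y • (P : Set G) := by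
        rw [Set.mem_inter_iff, mem_smul_iff_leftLe, mem_smul_iff_leftLe]
        refine ⟨LeftLe.mul_right x hp, ?_⟩
        rw [e']
        exact LeftLe.mul_right y hq
      rw [h] at this
      exact this.elim
    · exact ⟨z, (isLeftJoin_iff x y z).2 hz⟩
  · simpa only [isLeftJoin_iff] using hb x y z ((isLeftJoin_iff x y z).1 hz) s hs
  · intro a ha b hb' c hc' hba hbc z hz hbz
    refine hnot {a, c} ?_ b hb' (by simp [hba, hbc]) fun w hw => ?_
    · intro t ht
      rcases Finset.mem_insert.1 ht with rfl | ht
      · exact ha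
      · rwa [Finset.mem_singleton.1 ht]
    · exact hbz.trans (hz.le (hw a (by simp)) (hw c (by simp)))

end

/-! ### The cube complex as a projective resolution. -/

/-- An exact augmented chain complex is a resolution. -/
theorem ChainComplex.quasiIso_toSingle₀ {C : Type*} [Category* C] [Abelian C]
    (K : ChainComplex C ℕ) {Z : C} (f : {f : K.X 0 ⟶ Z // K.d 1 0 ≫ f = 0}) [Epi f.1]
    (h0 : (ShortComplex.mk _ _ f.2).Exact) (h : ∀ n, K.ExactAt (n + 1)) :
    QuasiIso ((ChainComplex.toSingle₀Equiv K Z).symm f) := ⟨fun n => by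
  cases n
  · rw [ChainComplex.quasiIsoAt₀_iff, ShortComplex.quasiIso_iff_of_zeros']
    · refine (ShortComplex.exact_and_epi_g_iff_of_iso (ShortComplex.isoMk (Iso.refl (K.X 1))
        (Iso.refl (K.X 0)) (Iso.refl Z) ?_ ?_)).1 ⟨h0, ‹Epi f.1›⟩
      · exact (Category.id_comp _).trans (Category.comp_id _).symm
      · refine (Category.id_comp _).trans (Eq.trans ?_ (Category.comp_id _).symm)
        exact ChainComplex.toSingle₀Equiv_symm_apply_f_zero _ _
    · exact K.shape _ _ (by simp)
    · exact HomologicalComplex.single_obj_d (ComplexShape.down ℕ) ..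
    · exact HomologicalComplex.single_obj_d (ComplexShape.down ℕ) ..
  · rw [quasiIsoAt_iff_exactAt']
    · exact h _
    · apply ChainComplex.exactAt_succ_single_obj⟩

namespace CubeComplex
open exteriorPower

variable {R : Type w} [CommRing R] {G : Type u} [Group G] {S : Type u} [Fintype S]

theorem subsingleton_chains (n : ℕ) (hn : Fintype.card S < n) :
    Subsingleton (Chains R G S n) := by
  nontriviality R
  have : Subsingleton (⋀[R]^n (S →₀ R)) := by
    apply Module.subsingleton_of_rank_zero (R := R)
    rw [← Module.finrank_eq_rank, exteriorPower.finrank_eq, Module.finrank_finsupp_self,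
      Nat.choose_eq_zero_of_lt hn]
    rfl
  infer_instance

variable [DecidableEq S] {P : Submonoid G} {v : S → G} {star : S → S → S}

/-- The cube complex as a chain complex of `R[G]`-modules. -/
noncomputable def complex (R : Type w) [CommRing R] (h : IsCubical v star) :
    ChainComplex (ModuleCat.{max u w} R[G]) ℕ :=
  ChainComplex.of (fun n => ModuleCat.of R[G] (Chains R G S n))
    (fun n => ModuleCat.ofHom (d v star n)) fun n => by
      refine ModuleCat.hom_ext (LinearMap.ext fun c => ?_)
      exact d_d h n c

theorem complex_d (h : IsCubical v star) (n : ℕ) :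
    (complex R h).d (n + 1) n = ModuleCat.ofHom (d v star n) :=
  by simp [complex]

variable {N : ModuleCat.{max u w} R[G]} [Module R N] [IsScalarTower R R[G] N]

/-- The cube complex as a projective resolution of a trivial module of rank one. -/
noncomputable def resolution (h : IsResidualSystem P v star) (e : R ≃ₗ[R] N)
    (he : ∀ (g : G) (x : N), MonoidAlgebra.of R G g • x = x) : ProjectiveResolution N where
  complex := complex R h.toIsCubical
  projective n := (IsProjective.iff_projective (R := R[G]) (Chains R G S n)).1 inferInstance
  π := (ChainComplex.toSingle₀Equiv _ _).symm ⟨ModuleCat.ofHom (augmentation S e), by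
    rw [complex_d]
    refine ModuleCat.hom_ext (LinearMap.ext fun c => ?_)
    exact augmentation_d he c⟩
  quasiIso := by
    have : Epi (ModuleCat.ofHom (augmentation (G := G) S e)) :=
      (ModuleCat.epi_iff_surjective _).2 (augmentation_surjective he)
    refine @ChainComplex.quasiIso_toSingle₀ _ _ _ _ _ _ this ?_ fun n => ?_
    · rw [ShortComplex.moduleCat_exact_iff]
      intro x hx
      obtain ⟨y, hy⟩ := h.exists_d_eq_of_augmentation_eq_zero he x hx
      exact ⟨y, (ConcreteCategory.congr_hom (complex_d h.toIsCubical 0) y).trans hy⟩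
    · rw [HomologicalComplex.exactAt_iff' _ (n + 1 + 1) (n + 1) n (by simp) (by simp),
        ShortComplex.moduleCat_exact_iff]
      intro x hx
      obtain ⟨y, hy⟩ := h.exists_d_eq n x
        ((ConcreteCategory.congr_hom (complex_d h.toIsCubical n) x).symm.trans hx)
      exact ⟨y, (ConcreteCategory.congr_hom (complex_d h.toIsCubical (n + 1)) y).trans hy⟩

theorem isZero_resolution_X (h : IsResidualSystem P v star) (e : R ≃ₗ[R] N)
    (he : ∀ (g : G) (x : N), MonoidAlgebra.of R G g • x = x) (n : ℕ)
    (hn : Fintype.card S < n) : Limits.IsZero ((resolution h e he).complex.X n) := by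
  have := subsingleton_chains (R := R) (G := G) (S := S) n hn
  exact ModuleCat.isZero_of_subsingleton (ModuleCat.of R[G] (Chains R G S n))

end CubeComplex

/-! ### Consequences of a resolution of finite length. -/

/-- An object with a projective resolution of length `n` has projective dimension at most `n`. -/
theorem CategoryTheory.ProjectiveResolution.hasProjectiveDimensionLE {C : Type*} [Category* C]
    [Abelian C] {Z : C} (F : ProjectiveResolution Z) (n : ℕ)
    (hF : ∀ i, n < i → Limits.IsZero (F.complex.X i)) : HasProjectiveDimensionLE Z n := by
  let K := F.complex
  -- Dimension shifting from the top: the opcycles vanish in degree `n + 1`, and those in degree `i`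
  -- are the quotient of the projective `K.X i` by those in degree `i + 1`.
  have key : ∀ j i, i + j = n + 1 → HasProjectiveDimensionLT (K.opcycles i) j := by
    intro j
    induction j with
    | zero =>
      intro i hi
      have : Limits.IsZero (K.X i) := hF i (by omega)
      have : Limits.IsZero (K.opcycles i) := by
        rw [Limits.IsZero.iff_id_eq_zero, ← cancel_epi (K.pOpcycles i)]
        exact this.eq_of_src _ _
      exact this.hasProjectiveDimensionLT_zero
    | succ j ih =>
      intro i hi
      have zero : K.fromOpcycles (i + 1) i ≫ K.pOpcycles i = 0 := by
        rw [← cancel_epi (K.pOpcycles (i + 1))]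
        simp
      have hex : (ShortComplex.mk _ _ zero).Exact := by
        have h1 : (ShortComplex.mk _ _ (K.d_pOpcycles (i + 1) i)).Exact :=
          ShortComplex.exact_of_g_is_cokernel _ (K.opcyclesIsCokernel (i + 1) i (by simp))
        let φ : ShortComplex.mk _ _ (K.d_pOpcycles (i + 1) i) ⟶ ShortComplex.mk _ _ zero :=
          { τ₁ := K.pOpcycles (i + 1)
            τ₂ := 𝟙 _
            τ₃ := 𝟙 _ }
        have : Epi φ.τ₁ := inferInstanceAs (Epi (K.pOpcycles (i + 1)))
        have : IsIso φ.τ₂ := inferInstanceAs (IsIso (𝟙 _))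
        have : Mono φ.τ₃ := inferInstanceAs (Mono (𝟙 _))
        exact (ShortComplex.exact_iff_of_epi_of_isIso_of_mono φ).1 h1
      have hmono : Mono (K.fromOpcycles (i + 1) i) :=
        Preadditive.mono_of_isZero_kernel' _ (K.homologyIsKernel (i + 1) i (by simp))
          ((F.complex_exactAt_succ i).isZero_homology)
      have hS : (ShortComplex.mk _ _ zero).ShortExact :=
        { exact := hex
          mono_f := hmono
          epi_g := inferInstanceAs (Epi (K.pOpcycles i)) }
      have : Projective (K.X i) := F.projective i
      exact hS.hasProjectiveDimensionLT_X₃ j (ih (i + 1) (by omega))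
        (inferInstanceAs (HasProjectiveDimensionLT (K.X i) (j + 1)))
  let e : K.opcycles 0 ≅ Z := (K.opcyclesIsCokernel 1 0 (by simp)).coconePointUniqueUpToIso
    F.isColimitCokernelCofork
  have := key (n + 1) 0 (by omega)
  exact hasProjectiveDimensionLT_of_iso e (n + 1)

/-- A projective resolution of an object is a projective resolution of each isomorphic object. -/
noncomputable def CategoryTheory.ProjectiveResolution.ofIso {C : Type*} [Category* C]
    [Abelian C] {Z Z' : C} (F : ProjectiveResolution Z) (e : Z ≅ Z') :
    ProjectiveResolution Z' where
  complex := F.complex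
  π := F.π ≫ (ChainComplex.single₀ C).map e.hom

section Rep

variable (k G : Type u) [CommRing k] [Group G]

instance : (Rep.ofModuleMonoidAlgebra.{u} (k := k) (G := G)).Additive where
  map_add := rfl

variable {k G}

/-- A resolution of the module of a representation, as a resolution of the representation. -/
noncomputable def Rep.resolutionOfModule {V : Rep.{u} k G}
    (F : ProjectiveResolution (Rep.toModuleMonoidAlgebra.obj V)) : ProjectiveResolution V :=
  (Rep.ofModuleMonoidAlgebra.mapProjectiveResolution F).ofIso
    (Rep.equivalenceModuleMonoidAlgebra.unitIso.app V).symm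

theorem Rep.isZero_resolutionOfModule_X {V : Rep.{u} k G}
    (F : ProjectiveResolution (Rep.toModuleMonoidAlgebra.obj V)) (i : ℕ)
    (h : Limits.IsZero (F.complex.X i)) :
    Limits.IsZero ((Rep.resolutionOfModule F).complex.X i) :=
  Rep.ofModuleMonoidAlgebra.map_isZero h

theorem isZero_groupHomology_of_isZero (A : Rep.{u} k G)
    (F : ProjectiveResolution (Rep.trivial k G k)) (i : ℕ)
    (h : Limits.IsZero (F.complex.X i)) : Limits.IsZero (groupHomology A i) := by
  classical
  refine Limits.IsZero.of_iso ?_ (groupHomologyIso A i F)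
  apply ShortComplex.isZero_homology_of_isZero_X₂
  exact ((Rep.coinvariantsTensor k G).obj A).map_isZero h

theorem isZero_groupCohomology_of_isZero (A : Rep.{u} k G)
    (F : ProjectiveResolution (Rep.trivial k G k)) (i : ℕ)
    (h : Limits.IsZero (F.complex.X i)) : Limits.IsZero (groupCohomology A i) := by
  refine Limits.IsZero.of_iso ?_ (groupCohomologyIso A i F)
  apply ShortComplex.isZero_homology_of_isZero_X₂
  have : Subsingleton (F.complex.X i ⟶ A) := ⟨fun f g => h.eq_of_src f g⟩
  exact ModuleCat.isZero_of_subsingleton (ModuleCat.of k (F.complex.X i ⟶ A))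

end Rep

theorem of_smul_trivial (k : Type*) [CommRing k] {G : Type*} [Group G] {V : Type*}
    [AddCommGroup V] [Module k V] (g : G)
    (x : (Rep.trivial k G V).ρ.asModule) : MonoidAlgebra.of k G g • x = x := by
  rw [MonoidAlgebra.of_apply, Representation.single_smul]
  exact one_smul k x

namespace CubeComplex

variable (k : Type w) [CommRing k] {G : Type u} [Group G] (V : Type (max u w)) [AddCommGroup V]
  [Module k V] (e : k ≃ₗ[k] V) {S : Type u} [Fintype S]
  [DecidableEq S] {P : Submonoid G} {v : S → G} {star : S → S → S}

/-- The cube complex as a resolution of a trivial representation of rank one. -/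
noncomputable def trivialResolution (h : IsResidualSystem P v star) :
    ProjectiveResolution (Rep.toModuleMonoidAlgebra.obj (Rep.trivial k G V)) :=
  resolution (N := ModuleCat.of k[G] (Rep.trivial k G V).ρ.asModule) h
    (e.trans (Representation.asModuleEquiv (Rep.trivial k G V).ρ).symm)
    fun g x => of_smul_trivial k g x

theorem isZero_trivialResolution_X (h : IsResidualSystem P v star) (i : ℕ)
    (hi : Fintype.card S < i) : Limits.IsZero ((trivialResolution k V e h).complex.X i) :=
  isZero_resolution_X (N := ModuleCat.of k[G] (Rep.trivial k G V).ρ.asModule) h _ _ i hi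

end CubeComplex

/-! ### The main theorem. -/

theorem mainTheorem5 {G : Type u} [Group G] (P : Submonoid G) (S : Finset G)
    (hS : Submonoid.closure (S : Set G) = P)
    (hqlo : IsLeftQuasiLatticeOrdered P) (hOre : IsRightOre P) (henv : IsEnvelopingGroup P)
    (hb : ∀ x y z : G, x • (P : Set G) ∩ y • (P : Set G) = z • (P : Set G) →
      ∀ s ∈ S, (x * s) • (P : Set G) ∩ y • (P : Set G) = z • (P : Set G) ∨
        ∃ t ∈ S, (x * s) • (P : Set G) ∩ y • (P : Set G) = (z * t) • (P : Set G))
    (hc : ∀ F : Finset G, F ⊆ S → ∀ s ∈ S, s ∉ F →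
      s • (P : Set G) ∩ (⋂ t ∈ F, t • (P : Set G)) ⊂ ⋂ t ∈ F, t • (P : Set G)) :
    IsTypeFL G ∧ cohomologicalDimension G ≤ (S.card : ℕ∞) ∧
      ∀ (M : Type u) [AddCommGroup M] [Module ℤ[G] M] (i : ℕ), S.card < i →
        CategoryTheory.Limits.IsZero (integralGroupHomology G M i) ∧
          CategoryTheory.Limits.IsZero (integralGroupCohomology G M i) := by
  classical
  have hL := isLatticeGenerating hS hqlo.1 hqlo.2 henv hb hc
  obtain ⟨star, hstar⟩ := hL.exists_residual
  have h := hL.isResidualSystem hstar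
  have hcard : Fintype.card S = S.card := Fintype.card_coe S
  let F : ProjectiveResolution (trivialModuleInt G) :=
    CubeComplex.trivialResolution ℤ (ULift.{u} ℤ) ULift.moduleEquiv.symm h
  have hF : ∀ i, S.card < i → Limits.IsZero (F.complex.X i) := fun i hi =>
    CubeComplex.isZero_trivialResolution_X _ _ _ h i (hcard ▸ hi)
  refine ⟨⟨F, S.card, fun i => ⟨?_, ?_⟩, hF⟩, ?_, ?_⟩
  · exact inferInstanceAs (Module.Free ℤ[G] (CubeComplex.Chains ℤ G S i))
  · exact inferInstanceAs (Module.Finite ℤ[G] (CubeComplex.Chains ℤ G S i))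
  · exact (projectiveDimension_le_iff _ _).2 (F.hasProjectiveDimensionLE _ hF)
  · intro M _ _ i hi
    -- Group homology and cohomology are taken over the lifted integers, so the cube complex is used
    -- again with these coefficients.
    let k := ULift.{u} ℤ
    let F' : ProjectiveResolution (Rep.trivial k G k) := Rep.resolutionOfModule
      (CubeComplex.trivialResolution k k (LinearEquiv.refl k k) h)
    have hF' : Limits.IsZero (F'.complex.X i) := Rep.isZero_resolutionOfModule_X _ i
      (CubeComplex.isZero_trivialResolution_X _ _ _ h i (hcard ▸ hi))
    exact ⟨isZero_groupHomology_of_isZero _ F' i hF', isZero_groupCohomology_of_isZero _ F' i hF'⟩
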